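/- Ranks are $0<1<2<\cdots<\vec\omega<\omega$, and $\mathcal F$ is a fixed free ultrafilter on $\mathbb N$. **Wgraphs.** Let $G^\nu=\{X^0,B,X^1,\dots,X^\nu\}$ be a wconnected transfinite wgraph of rank $\nu\le\omega$ (possibly $\nu=\vec\omega$). Here $X^0$ is a set of $0$-nodes, $B$ is a set of two-element subsets of $X^0$ (branches), and $X^\rho$ is the set of $\rho$-wnodes, nonempty for $\rho\ne\vec\omega$. A $0$-walk is an alternating sequence of $0$-nodes and branches, each branch joining its two neighbours. For $\rho\in\{1,2,\dots\}\cup\{\omega\}$, a $\rho$-walk is an alternating sequence of wnodes and walks of ranks $<\rho$, each of these reaching the two wnodes next to it; nonterminal wnodes have rank $\rho$ and are reached from at least one side through a $(\rho-1)$-wtip (where $\omega-1=\vec\omega$), and terminal wnodes have rank $\le\rho$. A one-ended $\vec\omega$-walk is defined likewise, with wnodes of strictly increasing natural number ranks; an endless one consists of two such walks with a common start, and there are no two-ended $\vec\omega$-walks. A $\mu$-wtip is a class of one-ended $\mu$-walks that are pairwise eventually identical. For $\rho\in\{1,2,\dots\}\cup\{\omega\}$, $\rho\le\nu$, the $\rho$-wnodes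 are the cells of a partition of the set of $(\rho-1)$-wtips, each enlarged by at most one wnode of lower rank (its exceptional element); no wnode is the exceptional element of two wnodes. An $\vec\omega$-wnode is an infinite sequence of wnodes of natural number ranks, each the exceptional element of the next, the first having none. A wnode embraces itself, its elements, the elements of these, and so on. A walk reaches a wnode that embraces its terminal wnode or its wtip. A wnode is not distinguished from one embracing it as regards the terminations of walks. Wconnected means that any two wnodes not so identified are joined by a two-ended walk. **Lengths.** A branch has length $1$. A two-ended walk has as length the natural sum of the lengths of its constituents. A one-ended $\mu$-walk has length $\omega^{\mu+1}$ and an endless one $\omega^{\mu+1}\cdot2$, with exponent $\omega$ for $\mu=\vec\omega$ and $\omega+1$ for $\mu=\omega$. **Wsections.** For $\rho\le\nu$, a $\rho$-wsection $S^\rho$ is a maximal $\rho$-wsubgraph with at least one branch in which any two wnodes are joined by a two-ended walk of rank $\le\rho$ lying in it; it is given by its branch set, and its wnodes are the wnodes of rank $\le\rho$ that embrace a branch end or a wtip represented in this branch set, together with the wnodes that they embrace. The wdistance $d(x,y)$ in $S^\rho$ is the minimum of the lengths of the two-ended walks in $S^\rho$ terminating at $x$ and $y$, and $0$ if one of $x,y$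 embraces the other. **Enlargements.** A hypernode of ${}^*S^\rho$ is a class modulo $\mathcal F$ of sequences of wnodes of $S^\rho$ of one common rank; it is standard if it is represented by a constant sequence. A hyperbranch is a class modulo $\mathcal F$ of sequences of branches of $S^\rho$. Hypernodes $[x_n],[y_n]$ of ${}^*S^\rho$ are $\rho$-limitedly distant if, for some $\mu\in\mathbb N$, $\{n: d(x_n,y_n)\le\omega^\rho\cdot\mu\}\in\mathcal F$ (for $\rho=\vec\omega$: $\{n: d(x_n,y_n)\le\omega^{\mu}\}\in\mathcal F$). The principal $\rho$-galaxy $\Gamma_0^\rho(S^\rho)$ of ${}^*S^\rho$ consists of the hypernodes that are $\rho$-limitedly distant from a standard hypernode of ${}^*S^\rho$ and of the hyperbranches whose incident $0$-hypernodes are among these. **Theorem 3.2.** Let $\alpha<\rho\le\nu$, and let $S^\alpha$ be an $\alpha$-wsection of $G^\nu$ lying in a $\rho$-wsection $S^\rho$ of $G^\nu$. Then every hypernode of the enlargement ${}^*S^\alpha$ is a hypernode of $\Gamma_0^\rho(S^\rho)$, and every hyperbranch of ${}^*S^\alpha$ is a hyperbranch of $\Gamma_0^\rho(S^\rho)$.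 -/

import Mathlib

open Filter

namespace TransfiniteWgraph

universe u

/-! ### Ranks -/

/-- The ranks `0, 1, 2, …, ω⃗, ω`; `arrow` is the rank `ω⃗`, which lies above all natural
numbers and below `ω`. -/
inductive WRank : Type
  | nat (n : ℕ)
  | arrow
  | omega

namespace WRank

/-- The position of a rank in the chain `0 < 1 < 2 < ⋯ < ω⃗ < ω`. -/
def toWithTop : WRank → WithTop (WithTop ℕ)
  | nat n => ((n : WithTop ℕ) : WithTop (WithTop ℕ))
  | arrow => ((⊤ : WithTop ℕ) : WithTop (WithTop ℕ))
  | omega => ⊤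

theorem toWithTop_injective : Function.Injective toWithTop := by
  intro a b h
  cases a <;> cases b <;> simp only [toWithTop, WithTop.coe_inj, reduceCtorEq] at h ⊢ <;>
    simp_all

noncomputable instance : LinearOrder WRank := LinearOrder.lift' toWithTop toWithTop_injective

/-- The rank of the wtips that are collected in wnodes of a given rank. A 0-wnode has no wtips (it
is met by branches), and neither has an `ω⃗`-wnode (it is a sequence of wnodes). -/
def tipRank : WRank → Option WRank
  | nat 0 => none
  | nat (n + 1) => some (nat n)
  | arrow => none
  | omega => some arrow

/-- The ordinal `e` such that one-ended walks of rank `r` have length `ω ^ e`. -/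
noncomputable def exponent : WRank → Ordinal.{0}
  | nat n => (n : Ordinal) + 1
  | arrow => Ordinal.omega0
  | omega => Ordinal.omega0 + 1

end WRank

/-- The natural (Hessenberg) sum of ordinals: coefficients of Cantor normal forms are added. -/
noncomputable def naturalAdd (a b : Ordinal.{0}) : Ordinal.{0} :=
  Ordinal.CNF.eval Ordinal.omega0
    (Ordinal.CNF.coeff Ordinal.omega0 a + Ordinal.CNF.coeff Ordinal.omega0 b)

/-! ### Alternating sequences -/

/-- Wnodes of all ranks; `X r` is the set of wnodes of rank `r`. -/
abbrev Node (X : WRank → Type u) : Type u := Σ r, X r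

/-- Nested alternating sequences of wnodes and sequences of lower rank, as yet without any
incidence condition. In `seq r I x W` the entries `W m` are those with `m ∈ I`, where `I` will be
a nonempty interval of integers, and `W m` stands between the wnodes `x m` and `x (m + 1)`:
`⟨…, x m, W m, x (m + 1), W (m + 1), …⟩`. Values of `W` outside `I` and values of `x` at indices
`m` with `m ∉ I` and `m - 1 ∉ I` are irrelevant. A single branch, a pair of 0-nodes, is the
bottom case. -/
inductive RawWalk (X : WRank → Type u) : Type u
  | branch (b : Sym2 (X (.nat 0))) : RawWalk X
  | seq (r : WRank) (I : Set ℤ) (x : ℤ → Node X) (W : ℤ → RawWalk X) : RawWalk X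

namespace RawWalk

variable {X : WRank → Type u}

/-- The rank of a sequence (none for a single branch). -/
def rank : RawWalk X → Option WRank
  | branch _ => none
  | seq r _ _ _ => some r

/-- The sequence traced in the opposite direction. -/
def reverse : RawWalk X → RawWalk X
  | branch b => branch b
  | seq r I x W =>
      seq r {m | -1 - m ∈ I} (fun m => x (-m)) (fun m => (W (-1 - m)).reverse)

/-- The sequence is infinite to the right. -/
def RightInfinite : RawWalk X → Prop
  | branch _ => False
  | seq _ I _ _ => ¬ BddAbove I

/-- The sequence is infinite to the left. -/
def LeftInfinite (w : RawWalk X) : Prop := w.reverse.RightInfinite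

/-- The sequence starts on the left at the wnode `y`. -/
def StartsAt : RawWalk X → Node X → Prop
  | branch _, _ => False
  | seq _ I x _, y => ∃ m, IsLeast I m ∧ y = x m

/-- The sequence stops on the right at the wnode `y`. -/
def StopsAt : RawWalk X → Node X → Prop
  | branch _, _ => False
  | seq _ I x _, y => ∃ m, IsGreatest I m ∧ y = x (m + 1)

/-- All the branches that are traversed. -/
def branches : RawWalk X → Set (Sym2 (X (.nat 0)))
  | branch b => {b}
  | seq _ I _ W => {b | ∃ m ∈ I, b ∈ (W m).branches}

/-- The two expressions denote the same alternating sequence, up to a shift of the indices (on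
every level of the nesting). -/
def Same : RawWalk X → RawWalk X → Prop
  | branch b, v => v = branch b
  | seq _ _ _ _, branch _ => False
  | seq r I x W, seq r' I' x' W' => r = r' ∧ ∃ c : ℤ, (∀ m, m ∈ I ↔ m + c ∈ I') ∧
      ∀ m ∈ I, x m = x' (m + c) ∧ x (m + 1) = x' (m + 1 + c) ∧ (W m).Same (W' (m + c))

/-- Two sequences that are infinite to the right are eventually identical. -/
def TailEquiv : RawWalk X → RawWalk X → Prop
  | seq r I x W, seq r' I' x' W' => r = r' ∧ ∃ m ∈ I, ∃ n ∈ I', ∀ k : ℕ,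
      m + k ∈ I ∧ n + k ∈ I' ∧ x (m + k) = x' (n + k) ∧ (W (m + k)).Same (W' (n + k))
  | _, _ => False

open Classical in
/-- The length of a walk. A branch has length 1. The length of a two-ended walk is the natural sum
of the lengths of its constituents (so that of a two-ended 0-walk is its number of branch
traversals). One-ended `r`-walks have length `ω ^ (r + 1)`, endless ones `ω ^ (r + 1) · 2`, where
`ω ^ (r + 1)` is to be read as `ω ^ ω` for `r = ω⃗`. -/
noncomputable def length : RawWalk X → Ordinal.{0}
  | branch _ => 1
  | seq r I _ W =>
      if h : I.Finite then
        (h.toFinset.sort (· ≤ ·)).foldr (fun m s => naturalAdd (W m).length s) 0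
      else if BddBelow I ∨ BddAbove I then Ordinal.omega0 ^ r.exponent
      else Ordinal.omega0 ^ r.exponent * 2

end RawWalk

/-! ### Wgraphs -/

/-- The data of a transfinite wgraph; the conditions on them are in `IsWgraph`. -/
structure WgraphData where
  /-- The set of wnodes of each rank. -/
  X : WRank → Type u
  /-- The underlying 0-graph; a branch is a two-element set of 0-nodes. -/
  G0 : SimpleGraph (X (.nat 0))
  /-- `HasTip w x`: the wtip represented by the walk `w` is an element of the wnode `x`. -/
  HasTip : RawWalk X → Node X → Prop
  /-- The exceptional element of a wnode, that is, the wnode of lower rank which it contains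
  besides its wtips, if there is one. -/
  exc : Node X → Option (Node X)
  /-- An `ω⃗`-wnode is a sequence of wnodes of natural number ranks. -/
  arrowSeq : X .arrow → ℕ → Node X

namespace WgraphData

variable (D : WgraphData.{u})

/-- The branch set. -/
abbrev branchSet : Set (Sym2 (D.X (.nat 0))) := D.G0.edgeSet

/-- `y` is an element of `x`. -/
def IsElement (x y : Node D.X) : Prop :=
  D.exc x = some y ∨ ∃ (a : D.X .arrow) (k : ℕ), x = ⟨.arrow, a⟩ ∧ y = D.arrowSeq a k

/-- `x` embraces `y`: `y` is `x`, or an element of `x`, or an element of an element of `x`, … -/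
def Embraces : Node D.X → Node D.X → Prop := Relation.ReflTransGen D.IsElement

/-- One of the two wnodes embraces the other, so that walks do not distinguish them. -/
def Linked (x y : Node D.X) : Prop := D.Embraces x y ∨ D.Embraces y x

/-- On its right, the walk reaches the wnode `y`: `y` embraces the wnode at which the walk stops,
or, if it does not stop, `y` embraces the wtip that it represents. -/
def RightReaches (w : RawWalk D.X) (y : Node D.X) : Prop :=
  (∃ z, w.StopsAt z ∧ D.Embraces y z) ∨
    (w.RightInfinite ∧ ∃ z, D.HasTip w z ∧ D.Embraces y z)

/-- On its left, the walk reaches the wnode `y`. -/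
def LeftReaches (w : RawWalk D.X) (y : Node D.X) : Prop := D.RightReaches w.reverse y

/-- `w` passes to `w'` through the wnode `y` in such a way that at least one of them reaches `y`
through a wtip of the highest possible rank (no condition if `y` has no wtips). -/
def PassesThroughTip (w : RawWalk D.X) (y : Node D.X) (w' : RawWalk D.X) : Prop :=
  ∀ s, y.1.tipRank = some s →
    (w.rank = some s ∧ w.RightInfinite) ∨ (w'.rank = some s ∧ w'.LeftInfinite)

/-- The walks of rank `0, 1, 2, …, ω⃗, ω`.

* A 0-walk is an alternating sequence of 0-nodes and branches, each branch being incident to the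
  two 0-nodes adjacent to it.
* For `r = 1, 2, …` and `r = ω`, an `r`-walk is an alternating sequence of wnodes and walks of
  ranks less than `r`, each of these walks reaching the two wnodes adjacent to it. Nonterminal
  wnodes are `r`-wnodes, and at least one of the two walks adjacent to such a wnode reaches it
  through an `(r - 1)`-wtip (an `ω⃗`-wtip for `r = ω`). Terminal wnodes have rank at most `r`.
* A one-ended `ω⃗`-walk is an alternating sequence of wnodes of strictly increasing natural number
  ranks and walks of natural number ranks, with the analogous conditions. An endless `ω⃗`-walk
  consists of two one-ended ones that start at the same wnode (of index `p` below). There are no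
  two-ended `ω⃗`-walks. -/
def IsWalk : RawWalk D.X → Prop
  | .branch _ => False
  | .seq (.nat 0) I x W => I.Nonempty ∧ I.OrdConnected ∧
      ∀ m ∈ I, ∃ a b, x m = ⟨.nat 0, a⟩ ∧ x (m + 1) = ⟨.nat 0, b⟩ ∧ D.G0.Adj a b ∧
        W m = .branch s(a, b)
  | .seq .arrow I x W => I.Nonempty ∧ I.OrdConnected ∧
      (∀ m ∈ I, IsWalk (W m) ∧ D.LeftReaches (W m) (x m) ∧ D.RightReaches (W m) (x (m + 1))) ∧
      (∀ m ∈ I, m + 1 ∈ I → D.PassesThroughTip (W m) (x (m + 1)) (W (m + 1))) ∧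
      (∀ m ∈ I, (x m).1 < .arrow ∧ (x (m + 1)).1 < .arrow ∧
        ∃ s, (W m).rank = some s ∧ s < max (x m).1 (x (m + 1)).1) ∧
      ∃ p : ℤ, (∀ m ∈ I, p ≤ m → (x m).1 < (x (m + 1)).1) ∧
        (∀ m ∈ I, m < p → (x (m + 1)).1 < (x m).1) ∧
        (BddBelow I → ∀ m ∈ I, p ≤ m) ∧ (BddAbove I → ∀ m ∈ I, m < p)
  | .seq r I x W => I.Nonempty ∧ I.OrdConnected ∧
      (∀ m ∈ I, IsWalk (W m) ∧ D.LeftReaches (W m) (x m) ∧ D.RightReaches (W m) (x (m + 1))) ∧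
      (∀ m ∈ I, m + 1 ∈ I →
        (x (m + 1)).1 = r ∧ D.PassesThroughTip (W m) (x (m + 1)) (W (m + 1))) ∧
      (∀ m ∈ I, (x m).1 ≤ r ∧ (x (m + 1)).1 ≤ r ∧ ∃ s, (W m).rank = some s ∧ s < r)

/-- `w` is a two-ended walk of rank at most `ρ` with all its branches in `S`, and it terminates at
`x` and `y`. Here wnodes of which one embraces the other are not distinguished. -/
def Joins (ρ : WRank) (S : Set (Sym2 (D.X (.nat 0)))) (w : RawWalk D.X) (x y : Node D.X) : Prop :=
  D.IsWalk w ∧ (∃ r, w.rank = some r ∧ r ≤ ρ) ∧ w.branches ⊆ S ∧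
    (∃ x', w.StartsAt x' ∧ D.Linked x x') ∧ ∃ y', w.StopsAt y' ∧ D.Linked y y'

/-- `x` and `y` are `ρ`-wconnected within `S`. -/
def WconnectedIn (ρ : WRank) (S : Set (Sym2 (D.X (.nat 0)))) (x y : Node D.X) : Prop :=
  D.Linked x y ∨ ∃ w, D.Joins ρ S w x y

/-- The conditions under which the data form a wconnected wgraph of rank `ν`. -/
structure IsWgraph (ν : WRank) : Prop where
  node_nonempty : ∀ r ≤ ν, r ≠ .arrow → Nonempty (D.X r)
  node_isEmpty : ∀ r, ν < r → IsEmpty (D.X r)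
  /-- A wnode with wtips has wtips of one rank only, represented by infinite walks. -/
  tip_isWalk : ∀ w x, D.HasTip w x →
    D.IsWalk w ∧ w.RightInfinite ∧ ∃ s, w.rank = some s ∧ x.1.tipRank = some s
  /-- The wnodes of a rank `r` partition the set of wtips of the preceding rank: every such wtip
  is in exactly one of them. -/
  tip_existsUnique : ∀ r ≤ ν, ∀ s, r.tipRank = some s → ∀ w, D.IsWalk w → w.RightInfinite →
    w.rank = some s → ∃! x, D.HasTip w x
  /-- No member of this partition is empty. -/
  tip_nonempty : ∀ x : Node D.X, ∀ s, x.1.tipRank = some s → ∃ w, D.HasTip w x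
  /-- A wtip is a class of walks that are eventually identical. (An endless walk represents, on
  its right, the same wtip as its one-ended parts.) -/
  tip_congr : ∀ w v x, D.IsWalk v → w.TailEquiv v → D.HasTip w x → D.HasTip v x
  /-- The exceptional element of a wnode has lower rank; `ω⃗`-wnodes do not have one. -/
  exc_rank : ∀ x y, D.exc x = some y → y.1 < x.1 ∧ x.1 ≠ .arrow
  /-- A wnode is the exceptional element of at most one wnode. -/
  exc_injective : ∀ x x' y, D.exc x = some y → D.exc x' = some y → x = x'
  /-- An `ω⃗`-wnode is an infinite sequence of wnodes of natural number ranks, each of them being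
  the exceptional element of the next one, and the first one having no exceptional element. -/
  arrow_rank : ∀ a k, (D.arrowSeq a k).1 < .arrow
  arrow_zero : ∀ a, D.exc (D.arrowSeq a 0) = none
  arrow_succ : ∀ a k, D.exc (D.arrowSeq a (k + 1)) = some (D.arrowSeq a k)
  arrow_injective : Function.Injective D.arrowSeq
  wconnected : ∀ x y, D.WconnectedIn ν D.branchSet x y

/-! ### Wsections -/

/-- The branch set `S` is incident to `x`: it contains a branch incident to `x` if `x` is a 0-node,
or a representative of a wtip in `x`. -/
def Meets (S : Set (Sym2 (D.X (.nat 0)))) (x : Node D.X) : Prop :=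
  (∃ a : D.X (.nat 0), x = ⟨.nat 0, a⟩ ∧ ∃ b ∈ S, a ∈ b) ∨
    ∃ w, D.HasTip w x ∧ w.branches ⊆ S

/-- The wnodes of the `ρ`-wsubgraph with branch set `S`: those which are incident to `S` through
a branch or a wtip that they embrace, together with all wnodes embraced by such a wnode. Only
wnodes of rank at most `ρ` are considered. -/
def nodesOf (ρ : WRank) (S : Set (Sym2 (D.X (.nat 0)))) : Set (Node D.X) :=
  {x | ∃ y z, y.1 ≤ ρ ∧ D.Embraces y x ∧ D.Embraces y z ∧ D.Meets S z}

/-- `S` is the branch set of a `ρ`-wsection, that is, of a maximal `ρ`-wconnected `ρ`-wsubgraph. -/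
def IsWsection (ρ : WRank) (S : Set (Sym2 (D.X (.nat 0)))) : Prop :=
  Maximal (fun T => T.Nonempty ∧ T ⊆ D.branchSet ∧
    ∀ x ∈ D.nodesOf ρ T, ∀ y ∈ D.nodesOf ρ T, D.WconnectedIn ρ T x y) S

open Classical in
/-- The wdistance in the `ρ`-wsubgraph with branch set `S`: the minimum of the lengths of the
two-ended walks in it that terminate at `x` and `y`, and zero if one of the wnodes embraces the
other. (In a wsection such walks always exist, since it is wconnected.) -/
noncomputable def wdist (ρ : WRank) (S : Set (Sym2 (D.X (.nat 0)))) (x y : Node D.X) :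
    Ordinal.{0} :=
  if D.Linked x y then 0 else sInf {l | ∃ w, D.Joins ρ S w x y ∧ w.length = l}

/-! ### Enlargements and galaxies -/

/-- `ω ^ ρ · μ` if `ρ` is a natural number or `ω`, and `ω ^ μ` if `ρ = ω⃗`. -/
noncomputable def limitBound : WRank → ℕ → Ordinal.{0}
  | .nat n, μ => Ordinal.omega0 ^ (n : Ordinal) * μ
  | .arrow, μ => Ordinal.omega0 ^ (μ : Ordinal)
  | .omega, μ => Ordinal.omega0 ^ Ordinal.omega0 * μ

variable (F : Ultrafilter ℕ)

/-- Hypernodes of all ranks: equivalence classes, modulo the ultrafilter, of sequences of wnodes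
of a common rank. -/
abbrev Hypernode : Type u := Σ γ : WRank, Germ (F : Filter ℕ) (D.X γ)

/-- Hyperbranches: equivalence classes of sequences of branches. -/
abbrev Hyperbranch : Type u := Germ (F : Filter ℕ) (Sym2 (D.X (.nat 0)))

/-- The hypernodes of the enlargement of the `ρ`-wsubgraph with branch set `S`: the classes of
sequences that lie in this wsubgraph for almost all `n`. -/
def hypernodesOf (ρ : WRank) (S : Set (Sym2 (D.X (.nat 0)))) : Set (D.Hypernode F) :=
  {x | x.2.LiftPred fun a => (⟨x.1, a⟩ : Node D.X) ∈ D.nodesOf ρ S}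

/-- The hyperbranches of the enlargement of the wsubgraph with branch set `S`. -/
def hyperbranchesOf (S : Set (Sym2 (D.X (.nat 0)))) : Set (D.Hyperbranch F) :=
  {b | b.LiftPred (· ∈ S)}

/-- The standard hypernode given by a constant sequence. -/
def standard (x : Node D.X) : D.Hypernode F :=
  ⟨x.1, ((x.2 : D.X x.1) : Germ (F : Filter ℕ) (D.X x.1))⟩

/-- Two hypernodes are `ρ`-limitedly distant in the enlargement of the `ρ`-wsubgraph with branch
set `S`. -/
def LimitedlyDistant (ρ : WRank) (S : Set (Sym2 (D.X (.nat 0)))) (x y : D.Hypernode F) : Prop :=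
  ∃ μ : ℕ, Germ.LiftRel (fun a b => D.wdist ρ S ⟨x.1, a⟩ ⟨y.1, b⟩ ≤ limitBound ρ μ) x.2 y.2

/-- The hypernodes of the principal `ρ`-galaxy of the enlargement of the `ρ`-wsection with branch
set `S`: those which are `ρ`-limitedly distant from a standard hypernode. -/
def principalHypernodes (ρ : WRank) (S : Set (Sym2 (D.X (.nat 0)))) : Set (D.Hypernode F) :=
  {x | x ∈ D.hypernodesOf F ρ S ∧
    ∃ y ∈ D.nodesOf ρ S, D.LimitedlyDistant F ρ S x (D.standard F y)}

/-- The hyperbranches of the principal `ρ`-galaxy: those whose incident 0-hypernodes are in it. -/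
def principalHyperbranches (ρ : WRank) (S : Set (Sym2 (D.X (.nat 0)))) : Set (D.Hyperbranch F) :=
  {b | b ∈ D.hyperbranchesOf F S ∧ ∀ x : Germ (F : Filter ℕ) (D.X (.nat 0)),
    Germ.LiftRel (fun a c => a ∈ c) x b → (⟨.nat 0, x⟩ : D.Hypernode F) ∈ D.principalHypernodes F ρ S}

end WgraphData

end TransfiniteWgraph

/-! Wdistances inside an `α`-wsection are bounded by one ordinal that depends only on `α` and `ρ`,
and this ordinal is `ρ`-limited. Hence any wnode of the `α`-wsection, taken as a standard hypernode,
is `ρ`-limitedly distant from every hypernode of the enlargement.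

The bound comes from lengths. A two-ended walk of rank `n` is a finite sequence of branches or of
walks of rank below `n`. Even endless, such constituents are shorter than `ω ^ (n + 1)`, and this
power is closed under natural sums (`naturalAdd_lt_omega0_opow`), so the whole walk is shorter too
(`IsWalk.length_lt_of_twoEnded`). For `α = ω⃗` every two-ended walk available has natural rank,
since none has rank `ω⃗`; all lengths are then below `ω ^ ω`, which suits `ρ = ω`, the only larger
rank. `exists_length_le_limitBound` collects the cases. Finally, walks in the smaller wsection are
also walks in the larger one, so wdistances there obey the same bound. -/

open Ordinal in
/-- Powers of `ω` are closed under the natural sum. -/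
theorem TransfiniteWgraph.naturalAdd_lt_omega0_opow {a b e : Ordinal.{0}}
    (ha : a < ω ^ e) (hb : b < ω ^ e) : naturalAdd a b < ω ^ e := by
  have coeff_lt : ∀ o d : Ordinal.{0}, CNF.coeff ω o d < ω := by
    intro o d
    by_cases h : d ∈ (CNF ω o).map Prod.fst
    · obtain ⟨⟨d', c⟩, hc, rfl⟩ := List.mem_map.1 h
      rw [CNF.coeff_of_mem_CNF hc]
      exact CNF.snd_lt one_lt_omega0 hc
    · rw [CNF.coeff_of_notMem_CNF h]
      exact omega0_pos
  have exponent_lt : ∀ o : Ordinal.{0}, o < ω ^ e → ∀ d, CNF.coeff ω o d ≠ 0 → d < e := by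
    intro o ho d hd
    have h : ω ^ d ≤ o := not_lt.1 fun h => hd (CNF.coeff_eq_zero_of_lt h)
    exact (opow_lt_opow_iff_right one_lt_omega0).1 (h.trans_lt ho)
  -- An expansion with finite coefficients and all exponents below `e` has value below `ω ^ e`; both
  -- properties survive adding coefficients.
  refine CNF.eval_lt (fun d => ?_) fun d hd => ?_
  · exact isPrincipal_add_omega0 (coeff_lt a d) (coeff_lt b d)
  · by_cases h : CNF.coeff ω a d = 0
    · refine exponent_lt b hb d fun h' => ?_
      simp [h, h'] at hd
    · exact exponent_lt a ha d h

namespace TransfiniteWgraph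

open Ordinal

/-! ### The order of the ranks -/

namespace WRank

theorem lt_iff_toWithTop {a b : WRank} : a < b ↔ a.toWithTop < b.toWithTop := Iff.rfl

@[simp]
theorem nat_lt_nat {m n : ℕ} : nat m < nat n ↔ m < n := by
  simp [lt_iff_toWithTop, toWithTop]

@[simp]
theorem nat_lt_arrow (m : ℕ) : nat m < arrow := by
  rw [lt_iff_toWithTop, toWithTop, toWithTop, WithTop.coe_lt_coe]
  exact WithTop.coe_lt_top m

@[simp]
theorem nat_lt_omega (m : ℕ) : nat m < omega := by
  rw [lt_iff_toWithTop, toWithTop, toWithTop]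
  exact WithTop.coe_lt_top _

@[simp]
theorem arrow_lt_omega : arrow < omega := by
  rw [lt_iff_toWithTop, toWithTop, toWithTop]
  exact WithTop.coe_lt_top _

theorem nat_zero_le (r : WRank) : nat 0 ≤ r := by
  cases r with
  | nat n => exact not_lt.1 fun h => by simp at h
  | arrow => exact (nat_lt_arrow 0).le
  | omega => exact (nat_lt_omega 0).le

theorem lt_nat_iff {r : WRank} {n : ℕ} : r < nat n ↔ ∃ k < n, r = nat k := by
  constructor
  · intro h
    cases r with
    | nat k => exact ⟨k, nat_lt_nat.1 h, rfl⟩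
    | arrow => exact absurd h (nat_lt_arrow n).not_gt
    | omega => exact absurd h (nat_lt_omega n).not_gt
  · rintro ⟨k, hk, rfl⟩
    exact nat_lt_nat.2 hk

end WRank

namespace WgraphData

/-! ### Bounds on the lengths of walks -/

variable {D : WgraphData}

theorem one_lt_omega0_opow {e : Ordinal.{0}} (he : 0 < e) : 1 < ω ^ e := by
  simpa using (opow_lt_opow_iff_right one_lt_omega0).2 he

theorem foldr_naturalAdd_lt {ι : Type*} {f : ι → Ordinal.{0}} {e : Ordinal.{0}} (l : List ι)
    (h : ∀ i ∈ l, f i < ω ^ e) : l.foldr (fun i s => naturalAdd (f i) s) 0 < ω ^ e := by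
  induction l with
  | nil => exact opow_pos _ omega0_pos
  | cons i l ih =>
    exact naturalAdd_lt_omega0_opow (h i (by simp)) (ih fun j hj => h j (by simp [hj]))

theorem length_seq_of_finite_lt {r : WRank} {I : Set ℤ} {x : ℤ → Node D.X}
    {W : ℤ → RawWalk D.X} {e : Ordinal.{0}} (hI : I.Finite)
    (h : ∀ m ∈ I, (W m).length < ω ^ e) : (RawWalk.seq r I x W).length < ω ^ e := by
  rw [RawWalk.length, dif_pos hI]
  exact foldr_naturalAdd_lt _ fun m hm => h m (by simpa using hm)

/-- The factor 2 is needed only for endless walks; one bound then serves every infinite walk. -/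
theorem length_seq_of_infinite_le {r : WRank} {I : Set ℤ} {x : ℤ → Node D.X}
    {W : ℤ → RawWalk D.X} (hI : ¬ I.Finite) :
    (RawWalk.seq r I x W).length ≤ ω ^ r.exponent * 2 := by
  rw [RawWalk.length, dif_neg hI]
  split_ifs
  · exact le_mul_left _ two_pos
  · exact le_rfl

/-- All walks of natural number rank `n` have length less than `ω ^ (n + 2)`. -/
theorem IsWalk.length_lt {w : RawWalk D.X} (hw : D.IsWalk w) {n : ℕ}
    (hn : w.rank = some (.nat n)) : w.length < ω ^ ((n + 2 : ℕ) : Ordinal.{0}) := by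
  induction w generalizing n with
  | branch b => exact absurd hn (by simp [RawWalk.rank])
  | seq r I x W ih =>
    obtain rfl : r = .nat n := by simpa [RawWalk.rank] using hn
    by_cases hI : I.Finite
    · refine length_seq_of_finite_lt hI fun m hm => ?_
      cases n with
      | zero =>
        rw [IsWalk] at hw
        obtain ⟨a, b, -, -, -, h⟩ := hw.2.2 m hm
        rw [h, RawWalk.length]
        exact one_lt_omega0_opow (by simp)
      | succ n =>
        -- The general clause of `IsWalk` applies only to ranks other than `0` and `ω⃗`; the rewrite
        -- leaves these inequalities as side goals.
        rw [IsWalk] at hw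
        · obtain ⟨s, hs, hsn⟩ := (hw.2.2.2.2 m hm).2.2
          obtain ⟨k, hk, rfl⟩ := WRank.lt_nat_iff.1 hsn
          refine (ih m (hw.2.2.1 m hm).1 hs).trans_le ?_
          exact opow_le_opow_right omega0_pos (by exact_mod_cast (by omega))
        all_goals simp
    · refine (length_seq_of_infinite_le hI).trans_lt ?_
      -- `ω ^ (n + 1) * 2 < ω ^ (n + 2)`: infinite walks are what forces the exponent `n + 2`.
      refine mul_lt_omega0_opow (by exact_mod_cast Nat.succ_pos _) ?_ (by exact_mod_cast natCast_lt_omega0 2)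
      exact (opow_lt_opow_iff_right one_lt_omega0).2 (by
        simp only [WRank.exponent]
        exact_mod_cast (by omega))

/-- A walk that has two terminal wnodes has finitely many entries. -/
theorem finite_of_startsAt_of_stopsAt {r : WRank} {I : Set ℤ} {x : ℤ → Node D.X}
    {W : ℤ → RawWalk D.X} {y z : Node D.X} (hy : (RawWalk.seq r I x W).StartsAt y)
    (hz : (RawWalk.seq r I x W).StopsAt z) : I.Finite := by
  obtain ⟨m, hm, -⟩ := hy
  obtain ⟨k, hk, -⟩ := hz
  exact (Set.finite_Icc m k).subset fun i hi => ⟨hm.2 hi, hk.2 hi⟩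

/-- A two-ended walk of natural number rank `n` has length less than `ω ^ (n + 1)`. -/
theorem IsWalk.length_lt_of_twoEnded {w : RawWalk D.X} (hw : D.IsWalk w) {y z : Node D.X}
    (hy : w.StartsAt y) (hz : w.StopsAt z) {n : ℕ} (hn : w.rank = some (.nat n)) :
    w.length < ω ^ ((n + 1 : ℕ) : Ordinal.{0}) := by
  cases w with
  | branch b => exact hy.elim
  | seq r I x W =>
    obtain rfl : r = .nat n := by simpa [RawWalk.rank] using hn
    refine length_seq_of_finite_lt (finite_of_startsAt_of_stopsAt hy hz) fun m hm => ?_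
    cases n with
    | zero =>
      rw [IsWalk] at hw
      obtain ⟨a, b, -, -, -, h⟩ := hw.2.2 m hm
      rw [h, RawWalk.length]
      exact one_lt_omega0_opow (by simp)
    | succ n =>
      rw [IsWalk] at hw
      · obtain ⟨s, hs, hsn⟩ := (hw.2.2.2.2 m hm).2.2
        obtain ⟨k, hk, rfl⟩ := WRank.lt_nat_iff.1 hsn
        -- The constituents may be infinite, so the weaker bound for arbitrary walks is used; their
        -- rank `k` is at most `n`, one below that of the whole walk, which gains the one exponent.
        refine (IsWalk.length_lt (hw.2.2.1 m hm).1 hs).trans_le ?_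
        exact opow_le_opow_right omega0_pos (by exact_mod_cast (by omega))
      all_goals simp

/-- There are no two-ended `ω⃗`-walks. -/
theorem IsWalk.rank_ne_arrow_of_twoEnded {w : RawWalk D.X} (hw : D.IsWalk w) {y z : Node D.X}
    (hy : w.StartsAt y) (hz : w.StopsAt z) : w.rank ≠ some .arrow := by
  intro h
  cases w with
  | branch b => exact hy
  | seq r I x W =>
    obtain rfl : r = .arrow := by simpa [RawWalk.rank] using h
    have hI := finite_of_startsAt_of_stopsAt hy hz
    rw [IsWalk] at hw
    obtain ⟨⟨m, hm⟩, -, -, -, -, p, -, -, hl, hr⟩ := hw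
    -- Boundedness on both sides would put every index both at or above and strictly below the
    -- turning index `p`.
    exact absurd (hl hI.bddBelow m hm) (hr hI.bddAbove m hm).not_ge

/-- The lengths of two-ended walks of rank at most `α < ρ` are uniformly `ρ`-limited. -/
theorem exists_length_le_limitBound {α ρ : WRank} (h : α < ρ) :
    ∃ μ : ℕ, ∀ (w : RawWalk D.X) (y z : Node D.X) (r : WRank), D.IsWalk w → w.StartsAt y →
      w.StopsAt z → w.rank = some r → r ≤ α → w.length ≤ limitBound ρ μ := by
  have key : ∀ n : ℕ, WRank.nat n < ρ →
      -- The argument `n + 1` serves all `ρ` at once: for `ω⃗` it is the exponent itself, while for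
      -- natural ranks and `ω` it is a factor that need only be positive.
      ω ^ ((n + 1 : ℕ) : Ordinal.{0}) ≤ limitBound ρ (n + 1) := by
    intro n hn
    cases ρ with
    | nat k =>
      refine (opow_le_opow_right omega0_pos ?_).trans (le_mul_left _ (by simp))
      exact_mod_cast WRank.nat_lt_nat.1 hn
    | arrow => exact le_rfl
    | omega =>
      exact (opow_le_opow_right omega0_pos (natCast_lt_omega0 _).le).trans
        (le_mul_left _ (by simp))
  cases α with
  | nat n =>
    refine ⟨n + 1, fun w y z r hw hy hz hr hrn => ?_⟩
    obtain ⟨k, hk, rfl⟩ : ∃ k < n + 1, r = .nat k :=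
      WRank.lt_nat_iff.1 (hrn.trans_lt (WRank.nat_lt_nat.2 n.lt_succ_self))
    refine ((hw.length_lt_of_twoEnded hy hz hr).le.trans ?_).trans (key n h)
    exact opow_le_opow_right omega0_pos (by exact_mod_cast hk)
  | arrow =>
    obtain rfl : ρ = .omega := by
      cases ρ with
      | nat k => exact absurd h (WRank.nat_lt_arrow k).not_gt
      | arrow => exact absurd h (lt_irrefl _)
      | omega => rfl
    refine ⟨1, fun w y z r hw hy hz hr hrn => ?_⟩
    cases r with
    | nat k =>
      refine (hw.length_lt_of_twoEnded hy hz hr).le.trans ?_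
      simpa [limitBound] using opow_le_opow_right omega0_pos (natCast_lt_omega0 (k + 1)).le
    | arrow => exact absurd hr (hw.rank_ne_arrow_of_twoEnded hy hz)
    | omega => exact absurd hrn WRank.arrow_lt_omega.not_ge
  | omega =>
    cases ρ with
    | nat k => exact absurd h (WRank.nat_lt_omega k).not_gt
    | arrow => exact absurd h WRank.arrow_lt_omega.not_gt
    | omega => exact absurd h (lt_irrefl _)

/-! ### Passing to larger wsubgraphs -/

variable {ρ σ : WRank} {S T : Set (Sym2 (D.X (.nat 0)))}

theorem Meets.mono (hST : S ⊆ T) {x : Node D.X} (h : D.Meets S x) : D.Meets T x := by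
  obtain ⟨a, rfl, b, hb, hab⟩ | ⟨w, hw, hwS⟩ := h
  · exact .inl ⟨a, rfl, b, hST hb, hab⟩
  · exact .inr ⟨w, hw, hwS.trans hST⟩

theorem nodesOf_mono (hρσ : ρ ≤ σ) (hST : S ⊆ T) : D.nodesOf ρ S ⊆ D.nodesOf σ T :=
  fun _ ⟨y, z, hy, hyx, hyz, hz⟩ => ⟨y, z, hy.trans hρσ, hyx, hyz, hz.mono hST⟩

/-- The 0-nodes incident to branches of `S` are wnodes of the wsubgraph with branch set `S`. -/
theorem zeroNode_mem_nodesOf {b : Sym2 (D.X (.nat 0))} (hb : b ∈ S) {a : D.X (.nat 0)}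
    (ha : a ∈ b) : (⟨.nat 0, a⟩ : Node D.X) ∈ D.nodesOf ρ S :=
  ⟨_, _, WRank.nat_zero_le ρ, .refl, .refl, .inl ⟨a, rfl, b, hb, ha⟩⟩

theorem Joins.mono (hρσ : ρ ≤ σ) (hST : S ⊆ T) {w : RawWalk D.X} {x y : Node D.X}
    (h : D.Joins ρ S w x y) : D.Joins σ T w x y :=
  let ⟨hw, ⟨r, hr, hrρ⟩, hwS, hxy⟩ := h
  ⟨hw, ⟨r, hr, hrρ.trans hρσ⟩, hwS.trans hST, hxy⟩

theorem Joins.wdist_le {w : RawWalk D.X} {x y : Node D.X} (h : D.Joins ρ S w x y) :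
    D.wdist ρ S x y ≤ w.length := by
  unfold wdist
  split_ifs
  · exact zero_le
  · exact csInf_le' ⟨w, h, rfl⟩

/-- Wnodes that are connected by walks of rank at most `α < ρ` within `S` have uniformly
`ρ`-limited wdistances in any larger wsubgraph. -/
theorem exists_wdist_le_limitBound {α : WRank} (h : α < ρ) (hST : S ⊆ T) :
    ∃ μ : ℕ, ∀ x y, D.WconnectedIn α S x y → D.wdist ρ T x y ≤ limitBound ρ μ := by
  obtain ⟨μ, hμ⟩ := exists_length_le_limitBound (D := D) h
  refine ⟨μ, ?_⟩
  rintro x y (hxy | ⟨w, hw⟩)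
  · rw [wdist, if_pos hxy]
    exact zero_le
  · refine (hw.mono h.le hST).wdist_le.trans ?_
    obtain ⟨hwalk, ⟨r, hr, hrα⟩, -, ⟨x', hx', -⟩, y', hy', -⟩ := hw
    exact hμ w x' y' r hwalk hx' hy' hr hrα

/-! ### Hypernodes and hyperbranches of the enlargements -/

theorem hypernodesOf_subset_principalHypernodes (F : Ultrafilter ℕ) {α : WRank} (h : α < ρ)
    (hS : D.IsWsection α S) (hST : S ⊆ T) :
    D.hypernodesOf F α S ⊆ D.principalHypernodes F ρ T := by
  obtain ⟨⟨b, hb⟩, -, hconn⟩ := hS.prop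
  obtain ⟨y, hy⟩ : ∃ y, y ∈ D.nodesOf α S := by
    induction b with
    | h a c => exact ⟨_, zeroNode_mem_nodesOf hb (Sym2.mem_mk_left a c)⟩
  -- `μ` is fixed before any representing sequence, so one bound holds for almost all `n`.
  obtain ⟨μ, hμ⟩ := exists_wdist_le_limitBound (D := D) h hST
  rintro ⟨γ, x⟩ hx
  induction x using Germ.inductionOn with
  | _ f =>
    have hf : ∀ᶠ n in (F : Filter ℕ), (⟨γ, f n⟩ : Node D.X) ∈ D.nodesOf α S := hx
    refine ⟨hf.mono fun n hn => nodesOf_mono h.le hST hn, y, nodesOf_mono h.le hST hy, μ, ?_⟩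
    exact hf.mono fun n hn => hμ _ _ (hconn _ hn _ hy)

theorem hyperbranchesOf_subset_principalHyperbranches (F : Ultrafilter ℕ) {α : WRank}
    (h : α < ρ) (hS : D.IsWsection α S) (hST : S ⊆ T) :
    D.hyperbranchesOf F S ⊆ D.principalHyperbranches F ρ T := by
  intro b hb
  induction b using Germ.inductionOn with
  | _ g =>
    have hg : ∀ᶠ n in (F : Filter ℕ), g n ∈ S := hb
    refine ⟨hg.mono fun n hn => hST hn, fun x hx => ?_⟩
    -- It suffices that an incident 0-hypernode lies in the enlargement of `S`: almost everywhere it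
    -- is an end of a branch in `S`.
    apply hypernodesOf_subset_principalHypernodes F h hS hST
    induction x using Germ.inductionOn with
    | _ f =>
      have hf : ∀ᶠ n in (F : Filter ℕ), f n ∈ g n := hx
      exact hg.mp (hf.mono fun n hn hn' => zeroNode_mem_nodesOf hn' hn)

end WgraphData

end TransfiniteWgraph

theorem theorem3p2 (F : Ultrafilter ℕ) (hF : (F : Filter ℕ) ≤ Filter.cofinite)
    (D : TransfiniteWgraph.WgraphData) (ν α ρ : TransfiniteWgraph.WRank) (hD : D.IsWgraph ν)
    (hαρ : α < ρ) (hρν : ρ ≤ ν) (Sα Sρ : Set (Sym2 (D.X (.nat 0))))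
    (hSα : D.IsWsection α Sα) (hSρ : D.IsWsection ρ Sρ) (hS : Sα ⊆ Sρ) :
    D.hypernodesOf F α Sα ⊆ D.principalHypernodes F ρ Sρ ∧
      D.hyperbranchesOf F Sα ⊆ D.principalHyperbranches F ρ Sρ :=
  ⟨TransfiniteWgraph.WgraphData.hypernodesOf_subset_principalHypernodes F hαρ hSα hS,
    TransfiniteWgraph.WgraphData.hyperbranchesOf_subset_principalHyperbranches F hαρ hSα hS⟩
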